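/- Throughout, a smooth immersed curve in $\mathbb{R}^2$ is a $C^\infty$ map from an interval $J\subseteq\mathbb{R}$ (of any kind; closed curves are included through their periodic parametrizations on $\mathbb{R}$) to $\mathbb{R}^2$ whose velocity vanishes nowhere (one-sided velocities are used at endpoints); self-intersections are allowed, and the curve is also identified with its image. Let $\gamma: J\to\mathbb{R}^2$ be a smooth immersed curve, let $I\subseteq\gamma(J)$ be an uncountable set of points, and for each $x\in I$ let $\gamma_x: K_x\to\mathbb{R}^2$ be a smooth immersed path, $K_x\subseteq\mathbb{R}$ an interval. Suppose that for every $x\in I$: (1) $\gamma_x(K_x)\cap\gamma(J)=\{x\}$; (2) there are $s\in J$ and an interior point $t$ of $K_x$ with $\gamma(s)=\gamma_x(t)=x$ such that $\gamma_x$ at time $t$ does not cross sides of the branch of $\gamma$ at $s$. Here crossing sides means that $s$ is an interior point of $J$ and that, in tubular coordinates $(s',r)\mapsto\gamma(s')+r\,R\gamma'(s')$ near $(s,0)$, where $R$ is the rotation by $\pi/2$, the path $\gamma_x$ lies in one of the two sides $\{r>0\}$, $\{r<0\}$ for all times just before $t$ and in the other side for all times just after $t$. Then there are $x\neq y$ in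 $I$ such that $\gamma_x(K_x)\cap\gamma_y(K_y)\neq\emptyset$. -/

import Mathlib

open Set Filter Topology
open scoped ContDiff

/-- The Euclidean plane. -/
abbrev Plane : Type := EuclideanSpace ℝ (Fin 2)

/-- `γ`, restricted to the interval `J` (open, closed, half-open, bounded or not), is a smooth
immersed curve in the plane: it is `C^∞` on `J` with nowhere vanishing velocity. The curve as a
subset of the plane is `γ '' J`. Velocities at endpoints that belong to `J` are one-sided, and a
degenerate `J` is excluded by the condition on the velocity. A closed curve is covered by
its periodic parametrization on `J = univ`. -/
structure IsSmoothImmersedCurve (J : Set ℝ) (γ : ℝ → Plane) : Prop where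
  ordConnected : J.OrdConnected
  contDiffOn : ContDiffOn ℝ ∞ γ J
  velocity_ne_zero : ∀ s ∈ J, derivWithin γ J s ≠ 0

/-- Rotation of the plane by a quarter turn, counterclockwise. -/
noncomputable def quarterTurn (v : Plane) : Plane := !₂[-(v 1), v 0]

/-- The tubular map of `γ`: the pair `(s, r)` goes to the point reached from `γ s` by moving along
the left normal by `r` (times the speed). Near `(s, 0)`, with `s` an interior parameter of an
immersed curve, it is a diffeomorphism onto a neighbourhood of `γ s`, and the curve is `r = 0`. -/
noncomputable def tubularMap (γ : ℝ → Plane) (p : ℝ × ℝ) : Plane :=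
  γ p.1 + p.2 • quarterTurn (deriv γ p.1)

/-- The filter of (germs at `γ s` of) the open left side `r > 0` of the branch of `γ` at `s`. -/
noncomputable def leftSide (γ : ℝ → Plane) (s : ℝ) : Filter Plane :=
  map (tubularMap γ) (𝓝 s ×ˢ 𝓝[>] 0)

/-- The filter of (germs at `γ s` of) the open right side `r < 0` of the branch of `γ` at `s`. -/
noncomputable def rightSide (γ : ℝ → Plane) (s : ℝ) : Filter Plane :=
  map (tubularMap γ) (𝓝 s ×ˢ 𝓝[<] 0)

/-- The path `c`, at time `t`, crosses sides of the branch at `s` of the curve `γ` on `J`: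
`s` is not an endpoint of `γ`, and `c` lies on one side of the branch just before `t` and on the
other side just after `t`. -/
def CrossesSides (J : Set ℝ) (γ : ℝ → Plane) (s : ℝ) (c : ℝ → Plane) (t : ℝ) : Prop :=
  s ∈ interior J ∧
    ((Tendsto c (𝓝[<] t) (leftSide γ s) ∧ Tendsto c (𝓝[>] t) (rightSide γ s)) ∨
      (Tendsto c (𝓝[<] t) (rightSide γ s) ∧ Tendsto c (𝓝[>] t) (leftSide γ s)))

/-! A path that touches `γ` only at `γ s` without crossing is tangent to `γ` there. In tubular
coordinates it therefore contains the graph of a function `f` on `|u - s| ≤ 1/(n+1)` that vanishes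
only at `s` and elsewhere has constant sign `b` (`exists_tubular_graph`). Endpoints of `J` account
for countably many points of `I`, and `n`, `b` and a cell of length `1/(n+1)` containing `s` take
countably many values, so two distinct points share all three. Between their parameters, each graph
is zero at its own end and has sign `b` at the other, so the graphs meet (`exists_mem_uIcc_eq`).
Equal coordinates give equal points, so injectivity of the tubular map is never needed. -/

theorem ContDiffAt.exists_contDiffAt_rightInverse {E F : Type*}
    [NormedAddCommGroup E] [NormedSpace ℝ E] [CompleteSpace E]
    [NormedAddCommGroup F] [NormedSpace ℝ F] {f : E → F} {f' : E ≃L[ℝ] F} {a : E}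
    {n : WithTop ℕ∞} (hf : ContDiffAt ℝ n f a) (hf' : HasFDerivAt f (f' : E →L[ℝ] F) a)
    (hn : n ≠ 0) :
    ∃ g : F → E, ContDiffAt ℝ n g (f a) ∧ g (f a) = a ∧ ∀ᶠ y in 𝓝 (f a), f (g y) = y :=
  ⟨hf.localInverse hf' hn, hf.to_localInverse hf' hn, hf.localInverse_apply_image hf' hn,
    (hf.hasStrictFDerivAt' hf' hn).eventually_right_inverse⟩

/-- The quarter turn as a continuous linear map. -/
noncomputable def quarterTurnCLM : Plane →L[ℝ] Plane :=
  LinearMap.toContinuousLinearMap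
    { toFun := quarterTurn
      map_add' := fun v w => by
        ext i; fin_cases i <;> simp [quarterTurn]; ring
      map_smul' := fun a v => by
        ext i; fin_cases i <;> simp [quarterTurn] }

theorem quarterTurnCLM_apply (v : Plane) : quarterTurnCLM v = quarterTurn v := rfl

theorem smul_add_smul_quarterTurn_eq_zero {v : Plane} (hv : v ≠ 0) {a b : ℝ}
    (h : a • v + b • quarterTurn v = 0) : a = 0 ∧ b = 0 := by
  have h0 : a * v 0 - b * v 1 = 0 := by
    simpa [quarterTurn, sub_eq_add_neg] using congrArg (fun w : Plane => w 0) h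
  have h1 : a * v 1 + b * v 0 = 0 := by
    simpa [quarterTurn] using congrArg (fun w : Plane => w 1) h
  have hn : v 0 ^ 2 + v 1 ^ 2 ≠ 0 := by
    intro hz
    apply hv
    have e0 : v 0 = 0 := by nlinarith [sq_nonneg (v 0), sq_nonneg (v 1)]
    have e1 : v 1 = 0 := by nlinarith [sq_nonneg (v 0), sq_nonneg (v 1)]
    ext i
    fin_cases i
    · simpa using e0
    · simpa using e1
  constructor
  · have : a * (v 0 ^ 2 + v 1 ^ 2) = 0 := by linear_combination v 0 * h0 + v 1 * h1
    exact (mul_eq_zero.1 this).resolve_right hn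
  · have : b * (v 0 ^ 2 + v 1 ^ 2) = 0 := by linear_combination v 0 * h1 - v 1 * h0
    exact (mul_eq_zero.1 this).resolve_right hn

/-- The differential of the tubular map on the zero section, for a branch of velocity `v`. -/
noncomputable def tubularEquiv (v : Plane) (hv : v ≠ 0) : (ℝ × ℝ) ≃L[ℝ] Plane :=
  (LinearMap.linearEquivOfInjective
    ((ContinuousLinearMap.fst ℝ ℝ ℝ).smulRight v +
      (ContinuousLinearMap.snd ℝ ℝ ℝ).smulRight (quarterTurn v) : (ℝ × ℝ) →L[ℝ] Plane).toLinearMap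
    (by
      rw [injective_iff_map_eq_zero]
      intro p hp
      exact Prod.ext_iff.2 (smul_add_smul_quarterTurn_eq_zero hv (by simpa using hp)))
    (by simp)).toContinuousLinearEquiv

theorem coe_tubularEquiv (v : Plane) (hv : v ≠ 0) :
    (tubularEquiv v hv : (ℝ × ℝ) →L[ℝ] Plane) = (ContinuousLinearMap.fst ℝ ℝ ℝ).smulRight v +
      (ContinuousLinearMap.snd ℝ ℝ ℝ).smulRight (quarterTurn v) := by
  ext p <;> rfl

theorem contDiffAt_tubularMap {γ : ℝ → Plane} {s : ℝ} (hγ : ContDiffAt ℝ ∞ γ s) (r : ℝ) :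
    ContDiffAt ℝ 1 (tubularMap γ) (s, r) := by
  have h1 : ContDiffAt ℝ 1 (fun p : ℝ × ℝ => γ p.1) (s, r) :=
    ContDiffAt.comp (s, r) (g := γ) (hγ.of_le (by simp)) contDiffAt_fst
  have h2 : ContDiffAt ℝ 1 (fun p : ℝ × ℝ => quarterTurnCLM (deriv γ p.1)) (s, r) :=
    quarterTurnCLM.contDiff.contDiffAt.comp (s, r)
      (ContDiffAt.comp (s, r) (g := deriv γ) ((ContDiffAt.derivWithin (m := ∞) hγ le_rfl).of_le (by simp)) contDiffAt_fst)
  exact h1.add (contDiffAt_snd.smul h2)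

theorem hasFDerivAt_tubularMap {γ : ℝ → Plane} {s : ℝ} (hγ : ContDiffAt ℝ ∞ γ s)
    (hv : deriv γ s ≠ 0) :
    HasFDerivAt (tubularMap γ) (tubularEquiv (deriv γ s) hv : (ℝ × ℝ) →L[ℝ] Plane) (s, 0) := by
  have h1 : HasFDerivAt (fun p : ℝ × ℝ => γ p.1)
      ((ContinuousLinearMap.fst ℝ ℝ ℝ).smulRight (deriv γ s)) (s, 0) :=
    HasFDerivAt.comp (s, (0 : ℝ)) (f := Prod.fst) (g := γ)
      (hγ.differentiableAt (by simp)).hasDerivAt.hasFDerivAt hasFDerivAt_fst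
  have hd : DifferentiableAt ℝ (deriv γ) s :=
    (ContDiffAt.derivWithin (m := ∞) hγ le_rfl).differentiableAt (by simp)
  have h2 : HasFDerivAt (fun p : ℝ × ℝ => quarterTurnCLM (deriv γ p.1)) _ (s, 0) :=
    quarterTurnCLM.hasFDerivAt.comp (s, (0 : ℝ))
      (HasFDerivAt.comp (s, (0 : ℝ)) (f := Prod.fst) (g := deriv γ) hd.hasFDerivAt hasFDerivAt_fst)
  have h3 := h1.add (hasFDerivAt_snd.smul h2)
  rw [coe_tubularEquiv]
  refine HasFDerivAt.congr_fderiv h3 ?_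
  ext p <;> simp [quarterTurnCLM_apply]

theorem tubularMap_zero (γ : ℝ → Plane) (s : ℝ) : tubularMap γ (s, 0) = γ s := by
  simp [tubularMap]

theorem IsPreconnected.forall_pos_or_forall_neg {X : Type*} [TopologicalSpace X] {S : Set X}
    (hS : IsPreconnected S) {ρ : X → ℝ} (hc : ContinuousOn ρ S) (h0 : ∀ u ∈ S, ρ u ≠ 0) :
    (∀ u ∈ S, 0 < ρ u) ∨ (∀ u ∈ S, ρ u < 0) := by
  by_contra! h
  obtain ⟨⟨a, ha, ha'⟩, b, hb, hb'⟩ := h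
  obtain ⟨u, hu, hu'⟩ := hS.intermediate_value ha hb hc ⟨ha', hb'⟩
  exact h0 u hu hu'

theorem eventually_sign_of_eventually_ne_zero {ρ : ℝ → ℝ} {t : ℝ}
    (hc : ∀ᶠ u in 𝓝 t, ContinuousAt ρ u) (h0 : ∀ᶠ u in 𝓝[≠] t, ρ u ≠ 0) :
    ((∀ᶠ u in 𝓝[<] t, 0 < ρ u) ∨ (∀ᶠ u in 𝓝[<] t, ρ u < 0)) ∧
    ((∀ᶠ u in 𝓝[>] t, 0 < ρ u) ∨ (∀ᶠ u in 𝓝[>] t, ρ u < 0)) := by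
  obtain ⟨ε, hε, h⟩ := Metric.eventually_nhds_iff.1 (hc.and (eventually_nhdsWithin_iff.1 h0))
  have hl : Ioo (t - ε) t ∈ 𝓝[<] t := Ioo_mem_nhdsLT (by linarith)
  have hr : Ioo t (t + ε) ∈ 𝓝[>] t := Ioo_mem_nhdsGT (by linarith)
  have hl' : ∀ u ∈ Ioo (t - ε) t, ContinuousAt ρ u ∧ ρ u ≠ 0 := fun u hu =>
    have := h (y := u) (by rw [Real.dist_eq, abs_lt]; constructor <;> linarith [hu.1, hu.2])
    ⟨this.1, this.2 hu.2.ne⟩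
  have hr' : ∀ u ∈ Ioo t (t + ε), ContinuousAt ρ u ∧ ρ u ≠ 0 := fun u hu =>
    have := h (y := u) (by rw [Real.dist_eq, abs_lt]; constructor <;> linarith [hu.1, hu.2])
    ⟨this.1, this.2 hu.1.ne'⟩
  exact ⟨(isPreconnected_Ioo.forall_pos_or_forall_neg
      (fun u hu => (hl' u hu).1.continuousWithinAt) fun u hu => (hl' u hu).2).imp
        (mem_of_superset hl) (mem_of_superset hl),
    (isPreconnected_Ioo.forall_pos_or_forall_neg
      (fun u hu => (hr' u hu).1.continuousWithinAt) fun u hu => (hr' u hu).2).imp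
        (mem_of_superset hr) (mem_of_superset hr)⟩

/-- A path in the half-plane coordinates `g` that touches the axis only at time `t` and stays on
one side is, near `t`, the graph of a function over the axis. -/
theorem exists_graph_of_sign {g : ℝ → ℝ × ℝ} {t s : ℝ} (hg : ContDiffAt ℝ 1 g t)
    (hg' : deriv g t ≠ 0) (ht : g t = (s, 0)) {b : ℤˣ}
    (hb : ∀ᶠ u in 𝓝[≠] t, 0 < ((b : ℤ) : ℝ) * (g u).2) :
    ∃ f : ℝ → ℝ, f s = 0 ∧ (∀ᶠ u in 𝓝 s, ContinuousAt f u) ∧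
      (∀ᶠ u in 𝓝[≠] s, 0 < ((b : ℤ) : ℝ) * f u) ∧
      ∀ {p : ℝ → Prop}, (∀ᶠ u in 𝓝 t, p u) → ∀ᶠ u in 𝓝 s, ∃ w, p w ∧ g w = (u, f u) := by
  have hd : HasDerivAt g (deriv g t) t := (hg.differentiableAt one_ne_zero).hasDerivAt
  have h1 : HasDerivAt (fun u => (g u).1) (deriv g t).1 t :=
    (ContinuousLinearMap.fst ℝ ℝ ℝ).hasFDerivAt.comp_hasDerivAt t hd
  have h2 : HasDerivAt (fun u => (g u).2) (deriv g t).2 t :=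
    (ContinuousLinearMap.snd ℝ ℝ ℝ).hasFDerivAt.comp_hasDerivAt t hd
  -- One-sidedness makes `t` an extremum of the height, so the velocity of `g` is horizontal and the
  -- first coordinate is locally invertible, with inverse `τ`.
  have hmin : IsLocalMin (fun u => ((b : ℤ) : ℝ) * (g u).2) t := by
    filter_upwards [eventually_nhdsWithin_iff.1 hb] with u hu
    rcases eq_or_ne u t with rfl | hut
    · exact le_rfl
    · simpa [ht] using (hu hut).le
  have hb0 : ((b : ℤ) : ℝ) ≠ 0 := by exact_mod_cast b.ne_zero
  have hz : (deriv g t).2 = 0 :=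
    (mul_eq_zero.1 (hmin.hasDerivAt_eq_zero (h2.const_mul _))).resolve_left hb0
  have hnz : (deriv g t).1 ≠ 0 := fun h => hg' (Prod.ext h hz)
  obtain ⟨τ, hτ, hτs, hτr⟩ := ContDiffAt.exists_contDiffAt_rightInverse (f := fun u => (g u).1)
    (f' := ContinuousLinearEquiv.unitsEquivAut ℝ (Units.mk0 _ hnz)) (a := t) (n := 1)
    (contDiffAt_fst.comp t hg) (by
      refine HasFDerivAt.congr_fderiv h1.hasFDerivAt ?_
      ext; simp) one_ne_zero
  simp only [ht] at hτ hτs hτr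
  have hτt : Tendsto τ (𝓝 s) (𝓝 t) := by simpa [hτs] using hτ.continuousAt.tendsto
  refine ⟨fun u => (g (τ u)).2, by simp [hτs, ht], ?_, ?_, ?_⟩
  · have : ContDiffAt ℝ 1 (fun u => (g (τ u)).2) s :=
      contDiffAt_snd.comp s (ContDiffAt.comp s (by rwa [hτs]) hτ)
    exact (this.eventually (by simp)).mono fun u hu => hu.continuousAt
  · rw [eventually_nhdsWithin_iff]
    filter_upwards [hτt.eventually (eventually_nhdsWithin_iff.1 hb), hτr] with u hu hur hus
    refine hu fun h => hus ?_
    rw [mem_singleton_iff] at h ⊢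
    rw [← hur, h, ht]
  · intro p hp
    filter_upwards [hτt.eventually hp, hτr] with u hu hur
    exact ⟨τ u, hu, Prod.ext hur rfl⟩

/-- A path that meets the immersed curve `γ` only at `γ s`, without crossing sides there, contains
the graph, in tubular coordinates, of a function over a neighbourhood of `s` which vanishes at `s`
only and has constant sign elsewhere. -/
theorem exists_tubular_graph {J : Set ℝ} {γ : ℝ → Plane} (hγ : IsSmoothImmersedCurve J γ)
    {K : Set ℝ} {c : ℝ → Plane} (hc : IsSmoothImmersedCurve K c) {s t : ℝ}
    (hmeet : c '' K ∩ γ '' J ⊆ {γ s}) (hs : s ∈ interior J) (ht : t ∈ interior K)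
    (hst : c t = γ s) (hcross : ¬ CrossesSides J γ s c t) :
    ∃ (n : ℕ) (b : ℤˣ) (f : ℝ → ℝ), f s = 0 ∧
      ∀ u, |u - s| ≤ 1 / ((n : ℝ) + 1) → ContinuousAt f u ∧
        (u ≠ s → 0 < ((b : ℤ) : ℝ) * f u) ∧ tubularMap γ (u, f u) ∈ c '' K := by
  have hJ : J ∈ 𝓝 s := mem_interior_iff_mem_nhds.1 hs
  have hK : K ∈ 𝓝 t := mem_interior_iff_mem_nhds.1 ht
  have hγs : ContDiffAt ℝ ∞ γ s := hγ.contDiffOn.contDiffAt hJ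
  have hct : ContDiffAt ℝ ∞ c t := hc.contDiffOn.contDiffAt hK
  have hγv : deriv γ s ≠ 0 := by
    rw [← derivWithin_of_mem_nhds hJ]; exact hγ.velocity_ne_zero s (mem_of_mem_nhds hJ)
  have hcv : deriv c t ≠ 0 := by
    rw [← derivWithin_of_mem_nhds hK]; exact hc.velocity_ne_zero t (mem_of_mem_nhds hK)
  have hcd : HasDerivAt c (deriv c t) t := (hct.differentiableAt (by simp)).hasDerivAt
  obtain ⟨Ψ, hΨ, hΨs, hΨr⟩ := ContDiffAt.exists_contDiffAt_rightInverse
    (contDiffAt_tubularMap hγs 0) (hasFDerivAt_tubularMap hγs hγv) one_ne_zero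
  rw [tubularMap_zero, ← hst] at hΨ hΨs hΨr
  set g : ℝ → ℝ × ℝ := fun u => Ψ (c u)
  have hg : ContDiffAt ℝ 1 g t := hΨ.comp t (hct.of_le (by simp))
  have hgt : g t = (s, 0) := hΨs
  have hcg : ∀ᶠ u in 𝓝 t, tubularMap γ (g u) = c u := hct.continuousAt.tendsto.eventually hΨr
  have hg' : deriv g t ≠ 0 := by
    intro h0
    have h1 : HasDerivAt g 0 t := h0 ▸ (hg.differentiableAt one_ne_zero).hasDerivAt
    have h2 : HasFDerivAt (tubularMap γ) _ (g t) := hgt ▸ hasFDerivAt_tubularMap hγs hγv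
    have h3 := (h2.comp_hasDerivAt t h1).congr_of_eventuallyEq
      (hcg.mono fun u hu => hu.symm : c =ᶠ[𝓝 t] _)
    exact hcv (by simpa using hcd.unique h3)
  have hgc : Tendsto g (𝓝 t) (𝓝 (s, 0)) := hgt ▸ hg.continuousAt.tendsto
  have hg1 : Tendsto (fun u => (g u).1) (𝓝 t) (𝓝 s) := (continuous_fst.tendsto _).comp hgc
  have hg2 : Tendsto (fun u => (g u).2) (𝓝 t) (𝓝 0) := (continuous_snd.tendsto _).comp hgc
  -- At height zero `c u` lies on `γ`, hence equals `γ s` by `hmeet`; the nonzero velocity of `c`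
  -- rules this out for `u ≠ t` near `t`.
  have hne : ∀ᶠ u in 𝓝[≠] t, (g u).2 ≠ 0 := by
    filter_upwards [hcd.eventually_ne (c := γ s) hcv, nhdsWithin_le_nhds hcg,
      nhdsWithin_le_nhds hK, nhdsWithin_le_nhds (hg1.eventually hJ)] with u hu hug huK huJ h0
    have : c u = γ (g u).1 := by
      rw [← hug, ← tubularMap_zero γ (g u).1, ← h0]
    exact hu (hmeet ⟨mem_image_of_mem c huK, this ▸ mem_image_of_mem γ huJ⟩)
  have hcont : ∀ᶠ u in 𝓝 t, ContinuousAt (fun u => (g u).2) u :=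
    (hg.eventually (by simp)).mono fun u hu => hu.continuousAt.snd
  have side : ∀ {l : Filter ℝ} {S : Set ℝ}, l ≤ 𝓝 t → (∀ᶠ u in l, (g u).2 ∈ S) →
      Tendsto c l (map (tubularMap γ) (𝓝 s ×ˢ 𝓝[S] 0)) := by
    intro l S hl hS
    refine Tendsto.congr' (hl hcg) (tendsto_map.comp ?_)
    exact (hg1.mono_left hl).prodMk
      (tendsto_nhdsWithin_iff.2 ⟨hg2.mono_left hl, hS⟩)
  -- The height has a constant sign on each side of `t`; opposite signs would be a crossing.
  have hsign : ∃ b : ℤˣ, ∀ᶠ u in 𝓝[≠] t, 0 < ((b : ℤ) : ℝ) * (g u).2 := by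
    rw [punctured_nhds_eq_nhdsWithin_sup_nhdsWithin]
    obtain ⟨hl | hl, hr | hr⟩ := eventually_sign_of_eventually_ne_zero hcont hne
    · exact ⟨1, by simpa using ⟨hl, hr⟩⟩
    · exact absurd ⟨hs, Or.inl ⟨side nhdsWithin_le_nhds hl, side nhdsWithin_le_nhds hr⟩⟩ hcross
    · exact absurd ⟨hs, Or.inr ⟨side nhdsWithin_le_nhds hl, side nhdsWithin_le_nhds hr⟩⟩ hcross
    · exact ⟨-1, by simpa using ⟨hl, hr⟩⟩
  obtain ⟨b, hb⟩ := hsign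
  obtain ⟨f, hfs, hfc, hfb, hfg⟩ := exists_graph_of_sign hg hg' hgt hb
  have hall := hfc.and ((eventually_nhdsWithin_iff.1 hfb).and
    (hfg (p := fun u => u ∈ K ∧ tubularMap γ (g u) = c u) ((Filter.eventually_mem_set.2 hK).and hcg)))
  obtain ⟨ε, hε, h⟩ := Metric.eventually_nhds_iff.1 hall
  obtain ⟨n, hn⟩ := exists_nat_one_div_lt hε
  refine ⟨n, b, f, hfs, fun u hu => ?_⟩
  obtain ⟨h1, h2, w, ⟨hwK, hw⟩, hgw⟩ := h (y := u) (by rw [Real.dist_eq]; linarith)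
  exact ⟨h1, h2, w, hwK, by rw [← hw, hgw]⟩

/-- A point of `J` with points of `J` strictly on both sides is interior, so only a least and a
greatest element can remain. -/
theorem Set.OrdConnected.countable_diff_interior {J : Set ℝ} (hJ : J.OrdConnected) :
    (J \ interior J).Countable := by
  have hsub : J \ interior J ⊆ {a | IsLeast J a} ∪ {a | IsGreatest J a} := by
    rintro a ⟨haJ, ha⟩
    by_contra! h
    simp only [mem_union, mem_ofPred_eq, IsLeast, IsGreatest, haJ, true_and, lowerBounds,
      upperBounds, not_or, not_forall, not_le] at h
    obtain ⟨⟨p, hp, hpa⟩, q, hq, haq⟩ := h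
    exact ha (mem_interior_iff_mem_nhds.2
      (mem_of_superset (Icc_mem_nhds hpa haq) (hJ.out hp hq)))
  refine Countable.mono hsub (Countable.union ?_ ?_) <;> apply Set.Subsingleton.countable
  · exact fun a ha b hb => IsLeast.unique ha hb
  · exact fun a ha b hb => IsGreatest.unique ha hb

/-- The difference `b * (f - g)` is nonpositive at `x` and nonnegative at `y`. The order of `x` and
`y` is left open, hence `uIcc`. -/
theorem exists_mem_uIcc_eq {f g : ℝ → ℝ} {x y : ℝ} (b : ℤˣ)
    (hf : ∀ u ∈ uIcc x y, ContinuousAt f u) (hg : ∀ u ∈ uIcc x y, ContinuousAt g u)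
    (hfx : f x = 0) (hgy : g y = 0) (hfy : 0 ≤ ((b : ℤ) : ℝ) * f y)
    (hgx : 0 ≤ ((b : ℤ) : ℝ) * g x) : ∃ u ∈ uIcc x y, f u = g u := by
  obtain ⟨u, hu, h⟩ := isPreconnected_uIcc.intermediate_value₂ left_mem_uIcc right_mem_uIcc
    (f := fun u => ((b : ℤ) : ℝ) * f u) (g := fun u => ((b : ℤ) : ℝ) * g u)
    (fun u hu => (continuousAt_const.mul (hf u hu)).continuousWithinAt)
    (fun u hu => (continuousAt_const.mul (hg u hu)).continuousWithinAt)
    (by simpa [hfx] using hgx) (by simpa [hgy] using hfy)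
  exact ⟨u, hu, mul_left_cancel₀ (by exact_mod_cast b.ne_zero) h⟩

theorem mainTheorem5
    (J : Set ℝ) (γ : ℝ → Plane) (hγ : IsSmoothImmersedCurve J γ)
    (I : Set Plane) (hIγ : I ⊆ γ '' J) (hI : ¬ I.Countable)
    (K : I → Set ℝ) (c : I → ℝ → Plane)
    (hc : ∀ x : I, IsSmoothImmersedCurve (K x) (c x))
    (hmeet : ∀ x : I, c x '' K x ∩ γ '' J = {(x : Plane)})
    (hside : ∀ x : I, ∃ s ∈ J, ∃ t ∈ interior (K x),
      γ s = x ∧ c x t = x ∧ ¬ CrossesSides J γ s (c x) t) :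
    ∃ x y : I, x ≠ y ∧ (c x '' K x ∩ c y '' K y).Nonempty := by
  choose s hsJ t htK hγs hct hcross using hside
  set A : Set I := {x | s x ∈ interior J}
  have hAc : ¬ A.Countable := by
    intro h
    apply hI
    refine ((h.image (fun x : I => (x : Plane))).union
      (hγ.ordConnected.countable_diff_interior.image γ)).mono fun x hx => ?_
    by_cases hxA : s ⟨x, hx⟩ ∈ interior J
    · exact Or.inl ⟨⟨x, hx⟩, hxA, rfl⟩
    · exact Or.inr ⟨_, ⟨hsJ _, hxA⟩, hγs _⟩
  have hgraph : ∀ x : A, _ := fun x => exists_tubular_graph hγ (hc x)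
    (by rw [hγs, hmeet]) x.2 (htK x) ((hct x).trans (hγs x).symm) (hcross x)
  choose n b f hfs hf using hgraph
  -- Equal floors put the two parameters within `1/(n+1)` of each other, so both graphs are defined
  -- over the whole interval between them.
  let key : A → ℕ × ℤˣ × ℤ := fun x => (n x, b x, ⌊s x * ((n x : ℝ) + 1)⌋)
  have hkey : ¬ Function.Injective key := fun h => hAc (countable_coe_iff.1 h.countable)
  obtain ⟨x, y, hxy, hne⟩ : ∃ x y, key x = key y ∧ x ≠ y := by
    simpa [Function.Injective] using hkey
  simp only [key, Prod.mk.injEq] at hxy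
  obtain ⟨hn, hb, hfl⟩ := hxy
  rw [← hn] at hfl
  have hpos : (0 : ℝ) < (n x : ℝ) + 1 := by positivity
  have hdist : |s x - s y| ≤ 1 / ((n x : ℝ) + 1) := by
    have habs : |s x - s y| * ((n x : ℝ) + 1) =
        |s x * ((n x : ℝ) + 1) - s y * ((n x : ℝ) + 1)| := by
      rw [← sub_mul, abs_mul, abs_of_pos hpos]
    rw [le_div_iff₀ hpos, habs]
    exact (Int.abs_sub_lt_one_of_floor_eq_floor hfl).le
  have hne' : (x : I) ≠ y := fun h => hne (Subtype.ext h)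
  have hsne : s x ≠ s y := fun h => hne' (Subtype.ext (by rw [← hγs x, ← hγs y, h]))
  have hx : ∀ u ∈ uIcc (s x) (s y), |u - s x| ≤ 1 / ((n x : ℝ) + 1) := fun u hu =>
    (abs_sub_left_of_mem_uIcc hu).trans (by rwa [abs_sub_comm])
  have hy : ∀ u ∈ uIcc (s x) (s y), |u - s y| ≤ 1 / ((n y : ℝ) + 1) := fun u hu => by
    rw [← hn, abs_sub_comm]
    exact (abs_sub_right_of_mem_uIcc hu).trans (by rwa [abs_sub_comm])
  obtain ⟨u, hu, hfu⟩ := exists_mem_uIcc_eq (b x) (fun u hu => (hf x u (hx u hu)).1)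
    (fun u hu => (hf y u (hy u hu)).1) (hfs x) (hfs y)
    ((hf x _ (hx _ right_mem_uIcc)).2.1 hsne.symm).le
    (hb ▸ ((hf y _ (hy _ left_mem_uIcc)).2.1 hsne).le)
  exact ⟨x, y, hne', _, (hf x u (hx u hu)).2.2, hfu ▸ (hf y u (hy u hu)).2.2⟩
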